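/- Let $X$ be a nonempty compact length space, i.e. a compact metric space (with finite metric $d$) in which $d(x,y)$ is the infimum of the lengths of the continuous paths from $x$ to $y$. Let $Y\subset X$ be closed and nonempty, let $F:Y\to\mathbb R$ be Lipschitz, and let $\epsilon>0$ and $\theta=\theta(\epsilon)\in(-1,1)$. Write $B_\epsilon(x)$ for the open ball of radius $\epsilon$. In the biased $\epsilon$-tug-of-war started at $x_0\in X$, at each step $k\ge 1$ an independent coin is tossed, which player I wins with probability $\frac{1+\theta}{2}$ and player II with probability $\frac{1-\theta}{2}$; the winner chooses $x_k\in B_\epsilon(x_{k-1})$. The game ends at the first time $\tau\ge 0$ with $x_\tau\in Y$, and player II then pays $F(x_\tau)$ to player I. A strategy for a player chooses the player's next move as a function of all previous coin tosses and moves. For strategies $\mathcal S_I,\mathcal S_{II}$ of the players, let $F_-(\mathcal S_I,\mathcal S_{II})=F_+(\mathcal S_I,\mathcal S_{II})=\mathbb E[F(x_\tau)]$ if the game ends with probability one, and $F_-=-\infty$, $F_+=+\infty$ otherwise. As functions of the starting point $x_0=x$, define $$u_I^\epsilon(x)=\sup_{\mathcal S_I}\inf_{\mathcal S_{II}}F_-(\mathcal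 S_I,\mathcal S_{II}),\qquad u_{II}^\epsilon(x)=\inf_{\mathcal S_{II}}\sup_{\mathcal S_I}F_+(\mathcal S_I,\mathcal S_{II}).$$ A bounded function $u:X\to\mathbb R$ is called $\theta(\epsilon)$-infinity harmonic if for all $x\in X\setminus Y$ $$u(x)=\frac{1+\theta}{2}\sup_{y\in B_\epsilon(x)}u(y)+\frac{1-\theta}{2}\inf_{y\in B_\epsilon(x)}u(y).$$ Then $u_I^\epsilon=u_{II}^\epsilon$ on $X$, this common value $u^\epsilon$ is real-valued and bounded, it is $\theta(\epsilon)$-infinity harmonic and agrees with $F$ on $Y$, and it is the only bounded $\theta(\epsilon)$-infinity harmonic function on $X$ that agrees with $F$ on $Y$. -/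

import Mathlib

open MeasureTheory

noncomputable section

namespace TugOfWar

/-- A (finite-valued) metric space is a length space if the distance between any two points is the
infimum of the lengths of the continuous paths joining them. -/
def IsLengthSpace (X : Type*) [MetricSpace X] : Prop :=
  ∀ x y : X, edist x y = ⨅ γ : Path x y, eVariationOn (fun t : unitInterval => γ t) Set.univ

/-- The record of a finite stretch of play, most recent round first. Each round is recorded by the
result of its coin toss (`true` if player I wins it) and by the position chosen in it. -/
abbrev History (X : Type*) := List (Bool × X)

/-- The current position, in a game started at `x₀`, after the rounds recorded in the history. -/
def currentPosition {X : Type*} (x₀ : X) : History X → X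
  | [] => x₀
  | (_, x) :: _ => x

/-- A strategy chooses the player's next move, at distance less than `ε` from the current position,
as a function of the starting point and of all previous coin tosses and moves. The move is carried
out only if the player wins the next coin toss. -/
structure Strategy (X : Type*) [MetricSpace X] (ε : ℝ) where
  move : X → History X → X
  dist_move_lt : ∀ (x₀ : X) (h : History X), dist (move x₀ h) (currentPosition x₀ h) < ε

/-- The law of a sequence of independent coin tosses, each of them `true` (player I wins) with
probability `(1 + θ) / 2` and `false` (player II wins) with probability `(1 - θ) / 2`, where
`-1 ≤ θ ≤ 1`. -/
def coinTosses (θ : ℝ) : Measure (ℕ → Bool) :=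
  Measure.infinitePi fun _ : ℕ =>
    ENNReal.ofReal ((1 + θ) / 2) • Measure.dirac true +
      ENNReal.ofReal ((1 - θ) / 2) • Measure.dirac false

theorem isProbabilityMeasure_coinTosses {θ : ℝ} (h₁ : -1 ≤ θ) (h₂ : θ ≤ 1) :
    IsProbabilityMeasure (coinTosses θ) := by
  have : IsProbabilityMeasure (ENNReal.ofReal ((1 + θ) / 2) • Measure.dirac true +
      ENNReal.ofReal ((1 - θ) / 2) • Measure.dirac false : Measure Bool) := by
    constructor
    simp only [Measure.coe_add, Measure.coe_smul, Pi.add_apply, Pi.smul_apply, measure_univ,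
      smul_eq_mul, mul_one]
    rw [← ENNReal.ofReal_add (by linarith) (by linarith)]
    ring_nf
    simp
  unfold coinTosses
  infer_instance

section Game

variable {X : Type*} [MetricSpace X] {ε : ℝ}

/-- The record of the first `n` rounds of the game started at `x₀`, when the players use the
strategies `S₁` and `S₂` and the coin tosses are `ω 0, ω 1, …`. -/
def playHistory (S₁ S₂ : Strategy X ε) (x₀ : X) (ω : ℕ → Bool) : ℕ → History X
  | 0 => []
  | n + 1 =>
    (ω n, if ω n = true then S₁.move x₀ (playHistory S₁ S₂ x₀ ω n)
      else S₂.move x₀ (playHistory S₁ S₂ x₀ ω n)) :: playHistory S₁ S₂ x₀ ω n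

/-- The position `xₙ` of the game after `n` rounds. -/
def gamePosition (S₁ S₂ : Strategy X ε) (x₀ : X) (ω : ℕ → Bool) (n : ℕ) : X :=
  currentPosition x₀ (playHistory S₁ S₂ x₀ ω n)

/-- The game ends: the terminal set `Y` is reached at some time (possibly at time `0`). -/
def GameEnds (Y : Set X) (S₁ S₂ : Strategy X ε) (x₀ : X) (ω : ℕ → Bool) : Prop :=
  ∃ n, gamePosition S₁ S₂ x₀ ω n ∈ Y

/-- The game ends with probability one. -/
def EndsAlmostSurely (Y : Set X) (θ : ℝ) (S₁ S₂ : Strategy X ε) (x₀ : X) : Prop :=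
  ∀ᵐ ω ∂coinTosses θ, GameEnds Y S₁ S₂ x₀ ω

open Classical in
/-- The amount `F (x_τ)` that player II pays to player I, where `τ` is the first time at which the
position lies in `Y`. (The value `0` for a game that does not end is never used: the
expectation is only taken for games that end almost surely.) -/
def payment {Y : Set X} (F : Y → ℝ) (S₁ S₂ : Strategy X ε) (x₀ : X) (ω : ℕ → Bool) : ℝ :=
  if h : GameEnds Y S₁ S₂ x₀ ω then F ⟨gamePosition S₁ S₂ x₀ ω (Nat.find h), Nat.find_spec h⟩
  else 0

/-- The expected payment. -/
def expectedPayment {Y : Set X} (F : Y → ℝ) (θ : ℝ) (S₁ S₂ : Strategy X ε) (x₀ : X) : ℝ :=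
  ∫ ω, payment F S₁ S₂ x₀ ω ∂coinTosses θ

open Classical in
/-- The payoff function `F₋`: the expected payment if the game ends with probability one, and `-∞`
otherwise. -/
def payoffMinus {Y : Set X} (F : Y → ℝ) (θ : ℝ) (S₁ S₂ : Strategy X ε) (x₀ : X) : EReal :=
  if EndsAlmostSurely Y θ S₁ S₂ x₀ then (expectedPayment F θ S₁ S₂ x₀ : EReal) else ⊥

open Classical in
/-- The payoff function `F₊`: the expected payment if the game ends with probability one, and `+∞`
otherwise. -/
def payoffPlus {Y : Set X} (F : Y → ℝ) (θ : ℝ) (S₁ S₂ : Strategy X ε) (x₀ : X) : EReal :=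
  if EndsAlmostSurely Y θ S₁ S₂ x₀ then (expectedPayment F θ S₁ S₂ x₀ : EReal) else ⊤

/-- The value `u_I^ε` of the `ε`-game with bias `θ` for player I. -/
def valueI {Y : Set X} (F : Y → ℝ) (ε θ : ℝ) (x : X) : EReal :=
  ⨆ S₁ : Strategy X ε, ⨅ S₂ : Strategy X ε, payoffMinus F θ S₁ S₂ x

/-- The value `u_II^ε` of the `ε`-game with bias `θ` for player II. -/
def valueII {Y : Set X} (F : Y → ℝ) (ε θ : ℝ) (x : X) : EReal :=
  ⨅ S₂ : Strategy X ε, ⨆ S₁ : Strategy X ε, payoffPlus F θ S₁ S₂ x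

/-- A bounded real function. -/
def IsBoundedFun (u : X → ℝ) : Prop := ∃ C : ℝ, ∀ x, |u x| ≤ C

/-- The equation of a `θ(ε)`-infinity harmonic function, at all points outside `Y`; it is used for
bounded functions only, and then the supremum and the infimum are finite. -/
def IsInfinityHarmonic (Y : Set X) (ε θ : ℝ) (u : X → ℝ) : Prop :=
  ∀ x, x ∉ Y → u x = (1 + θ) / 2 * sSup (u '' Metric.ball x ε) +
    (1 - θ) / 2 * sInf (u '' Metric.ball x ε)

end Game

end TugOfWar

end

/-! A bounded solution exists by a Perron argument: the one-step averaging operator is monotone and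
preserves the functions bounded by `C`, so its least supersolution among them is a fixed point
(`exists_isInfinityHarmonic`). Everything else follows from showing `u ≤ valueI ≤ valueII ≤ u` for
every bounded harmonic `u` with boundary values `F`: the values do not mention `u`, so uniqueness
comes for free.

For `u ≤ valueI`, player I should move to nearly maximize `u`, but this alone need not end the game.
The remedy is a strict subsolution `w` within `c` of `u`, together with a stationary rule under
which `w` gains at least `l > 0` per round on average, whatever player II does
(`exists_strict_subsolution`). As `w` is bounded, the game ends almost surely and pays at least `w
x₀` on average (`endsAlmostSurely_and_le_expectedPayment`). The bound for player II is the same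
statement for `-u`, with the two probabilities exchanged.

To build `w`, subtract from `u` a small penalty that grows with the number of nearly maximizing
steps needed to reach `Y`. This number has a bound independent of the permitted loss `l`
(`exists_goodReach_eq_univ`). Where `u` is nearly flat, every step is nearly maximizing, so any
short route to `Y` may be followed. Where it is not, greedy ascent keeps a definite slope until it
hits `Y`, and compactness limits how long that can last (`exists_iterate_mem`). -/

namespace TugOfWar

/-! ### Metric consequences of compactness and connectedness -/

section Separation

/-- In a totally bounded space, a long enough sequence has two nonconsecutive terms at distance
less than `ε`. -/
theorem exists_dist_lt_of_compact {X : Type*} [MetricSpace X] [CompactSpace X] {ε : ℝ}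
    (hε : 0 < ε) :
    ∃ N : ℕ, ∀ x : ℕ → X, ∃ i j, i + 2 ≤ j ∧ j ≤ N ∧ dist (x j) (x i) < ε := by
  obtain ⟨t, -, htf, ht⟩ := Metric.finite_approx_of_totallyBounded
    (isCompact_univ (X := X)).totallyBounded (ε / 2) (half_pos hε)
  have hc : ∀ y : X, ∃ c ∈ t, dist y c < ε / 2 := fun y => by
    simpa using ht (Set.mem_univ y)
  choose c hct hcd using hc
  -- The pigeonhole is applied to even indices only, so that distinct indices differ by at least
  -- two.
  refine ⟨2 * htf.toFinset.card, fun x => ?_⟩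
  obtain ⟨a, ha, b, hb, hab, he⟩ := Finset.exists_ne_map_eq_of_card_lt_of_maps_to
    (s := Finset.range (htf.toFinset.card + 1)) (t := htf.toFinset)
    (f := fun k => c (x (2 * k))) (by simp) (fun k _ => by simpa using hct _)
  have key : ∀ a b : ℕ, c (x (2 * a)) = c (x (2 * b)) → dist (x (2 * b)) (x (2 * a)) < ε := by
    intro a b he
    have h₁ := hcd (x (2 * a))
    have h₂ := hcd (x (2 * b))
    rw [he] at h₁
    have := dist_triangle_right (x (2 * b)) (x (2 * a)) (c (x (2 * b)))
    linarith
  rw [Finset.mem_range] at ha hb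
  rcases lt_or_gt_of_ne hab with h | h
  · exact ⟨2 * a, 2 * b, by omega, by omega, key a b he⟩
  · exact ⟨2 * b, 2 * a, by omega, by omega, key b a he.symm⟩

/-- Without a path between two points, the infimum of lengths would be `⊤`, whereas distances are
finite. -/
theorem IsLengthSpace.preconnectedSpace {X : Type*} [MetricSpace X] (hX : IsLengthSpace X) :
    PreconnectedSpace X := by
  refine ⟨isPreconnected_of_forall_pair fun x _ y _ => ?_⟩
  have hne : Nonempty (Path x y) := by
    by_contra h
    rw [not_nonempty_iff] at h
    have := hX x y
    rw [iInf_of_empty] at this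
    exact edist_ne_top x y this
  obtain ⟨γ⟩ := hne
  exact ⟨Set.range γ, Set.subset_univ _, ⟨0, γ.source⟩, ⟨1, γ.target⟩,
    isPreconnected_range γ.continuous⟩

/-- The points from which `Y` can be reached in at most `n` steps of size less than `ε`. -/
def reach {X : Type*} [MetricSpace X] (ε : ℝ) (Y : Set X) : ℕ → Set X
  | 0 => Y
  | n + 1 => Metric.thickening ε (reach ε Y n)

/-- The union of the thickenings is open, and closed because a limit point is within `ε` of it.
Connectedness makes it everything and compactness stops at a finite stage. -/
theorem exists_reach_eq_univ {X : Type*} [MetricSpace X] [CompactSpace X]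
    [PreconnectedSpace X] {ε : ℝ} (hε : 0 < ε) {Y : Set X} (hY : Y.Nonempty) :
    ∃ n, reach ε Y n = Set.univ := by
  have hmono : Monotone (reach ε Y) :=
    monotone_nat_of_le_succ fun n => Metric.self_subset_thickening hε _
  have hopen : ∀ n, IsOpen (reach ε Y (n + 1)) := fun n => Metric.isOpen_thickening
  have hunion : ⋃ n, reach ε Y (n + 1) = Set.univ := by
    refine IsClopen.eq_univ ⟨?_, isOpen_iUnion hopen⟩ ?_
    · rw [← closure_subset_iff_isClosed]
      intro x hx
      obtain ⟨z, hz, hd⟩ := Metric.mem_closure_iff.1 hx ε hε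
      obtain ⟨n, hn⟩ := Set.mem_iUnion.1 hz
      exact Set.mem_iUnion.2 ⟨n + 1, Metric.mem_thickening_iff.2 ⟨z, hn, hd⟩⟩
    · obtain ⟨y, hy⟩ := hY
      exact ⟨y, Set.mem_iUnion.2 ⟨0, Metric.self_subset_thickening hε _ hy⟩⟩
  obtain ⟨n, hn⟩ := isCompact_univ.elim_directed_cover _ hopen hunion.ge
    (Monotone.directed_le fun a b h => hmono (Nat.add_le_add_right h 1))
  exact ⟨n + 1, Set.univ_subset_iff.1 hn⟩

end Separation

section Bounded

variable {X : Type*}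

theorem IsBoundedFun.bddAbove_image {u : X → ℝ} (hu : IsBoundedFun u) (s : Set X) :
    BddAbove (u '' s) := by
  obtain ⟨C, hC⟩ := hu
  exact ⟨C, by rintro _ ⟨x, -, rfl⟩; exact (abs_le.1 (hC x)).2⟩

theorem IsBoundedFun.bddBelow_image {u : X → ℝ} (hu : IsBoundedFun u) (s : Set X) :
    BddBelow (u '' s) := by
  obtain ⟨C, hC⟩ := hu
  exact ⟨-C, by rintro _ ⟨x, -, rfl⟩; exact (abs_le.1 (hC x)).1⟩

theorem IsBoundedFun.neg {u : X → ℝ} (hu : IsBoundedFun u) : IsBoundedFun fun x => -u x := by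
  simpa [IsBoundedFun] using hu

end Bounded

/-! ### Greedy ascent and strict subsolutions -/

section Harmonic

variable {X : Type*} [MetricSpace X] {ε : ℝ}

/-- The points from which `Y` can be reached in at most `n` steps of size less than `ε`, each of
which falls short of the supremum of `u` over the ball by at most `l`. -/
def goodReach (ε : ℝ) (Y : Set X) (u : X → ℝ) (l : ℝ) : ℕ → Set X
  | 0 => Y
  | n + 1 => goodReach ε Y u l n ∪
      {x | ∃ z ∈ Metric.ball x ε, sSup (u '' Metric.ball x ε) - l ≤ u z ∧
        z ∈ goodReach ε Y u l n}

theorem goodReach_mono (Y : Set X) (u : X → ℝ) (l : ℝ) : Monotone (goodReach ε Y u l) :=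
  monotone_nat_of_le_succ fun _ => Set.subset_union_left

variable {Y : Set X} {u : X → ℝ} {p q : ℝ}

/-- A chain of nearly maximizing steps of a harmonic function, starting at a point from which the
function can increase by a definite amount, reaches `Y` in a bounded number of steps. -/
theorem exists_iterate_mem (hp : 0 < p) (hq : 0 < q) (hpq : p + q = 1)
    (hb : IsBoundedFun u)
    (hu : ∀ x, x ∉ Y →
      u x = p * sSup (u '' Metric.ball x ε) + q * sInf (u '' Metric.ball x ε))
    {N : ℕ} (hN : ∀ x : ℕ → X, ∃ i j, i + 2 ≤ j ∧ j ≤ N ∧ dist (x j) (x i) < ε)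
    {b k : ℝ} (hk : 0 < k) (hkb : 4 * k ≤ (q / 2) ^ N * b) {s : X → X}
    (hs : ∀ x, s x ∈ Metric.ball x ε)
    (hsu : ∀ x, sSup (u '' Metric.ball x ε) - k ≤ u (s x))
    (x : X) (hx : b ≤ sSup (u '' Metric.ball x ε) - u x) :
    ∃ i ≤ N, s^[i] x ∈ Y := by
  by_contra! hY
  have hq1 : q / 2 ≤ 1 := by linarith
  have hb0 : 0 < b := by
    by_contra! h
    have : (q / 2) ^ N * b ≤ 0 := mul_nonpos_of_nonneg_of_nonpos (by positivity) h
    linarith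
  have hsucc : ∀ i, s^[i + 1] x = s (s^[i] x) := fun i => Function.iterate_succ_apply' s i x
  set d : ℕ → ℝ := fun i => sSup (u '' Metric.ball (s^[i] x) ε) - u (s^[i] x) with hd
  have hk4 : ∀ i ≤ N, 4 * k ≤ (q / 2) ^ i * b := fun i hi =>
    hkb.trans (mul_le_mul_of_nonneg_right (pow_le_pow_of_le_one (by positivity) hq1 hi) hb0.le)
  have hstep : ∀ i, d i - k ≤ u (s^[i + 1] x) - u (s^[i] x) := fun i => by
    have := hsu (s^[i] x)
    rw [hsucc]
    simp only [hd]
    linarith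
  -- The slope shrinks at most by the factor `q / 2` per step. Off `Y`, harmonicity turns the drop
  -- below the new point into slope above it, and the drop is at least the last increment because
  -- the previous point lies in the new ball.
  have hdi : ∀ i ≤ N, (q / 2) ^ i * b ≤ d i := by
    intro i
    induction i with
    | zero => intro _; simpa [hd] using hx
    | succ i ih =>
      intro hi
      have h₁ := ih (by omega)
      have h₂ := hk4 i (by omega)
      have h₃ := hu _ (hY (i + 1) hi)
      have h₄ : sInf (u '' Metric.ball (s^[i + 1] x) ε) ≤ u (s^[i] x) := by
        refine csInf_le (hb.bddBelow_image _) ⟨_, ?_, rfl⟩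
        have := hs (s^[i] x)
        rw [← hsucc] at this
        rwa [Metric.mem_ball, dist_comm]
      have h₅ := hstep i
      set S := sSup (u '' Metric.ball (s^[i + 1] x) ε) with hS
      set I := sInf (u '' Metric.ball (s^[i + 1] x) ε)
      have h₆ : d (i + 1) = S - u (s^[i + 1] x) := rfl
      have h₇ : p * d (i + 1) = q * (u (s^[i + 1] x) - I) := by
        rw [h₆]
        have : u (s^[i + 1] x) = (p + q) * u (s^[i + 1] x) := by rw [hpq, one_mul]
        linarith
      have h₈ : q * ((q / 2) ^ i * b / 2) ≤ q * (u (s^[i + 1] x) - I) := by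
        apply mul_le_mul_of_nonneg_left _ hq.le
        linarith
      have h₉ : 0 ≤ d (i + 1) := by
        have : 0 ≤ p * d (i + 1) := by
          rw [h₇]; exact le_trans (by positivity) h₈
        exact nonneg_of_mul_nonneg_right this hp
      have h₁₀ : p * d (i + 1) ≤ d (i + 1) := mul_le_of_le_one_left h₉ (by linarith)
      calc (q / 2) ^ (i + 1) * b = q * ((q / 2) ^ i * b / 2) := by ring
        _ ≤ d (i + 1) := by linarith
  have hinc : ∀ i ≤ N, 3 * k ≤ u (s^[i + 1] x) - u (s^[i] x) := fun i hi => by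
    have := hdi i hi
    have := hk4 i hi
    have := hstep i
    linarith
  have hmono : ∀ i j, i ≤ j → j ≤ N → u (s^[i] x) ≤ u (s^[j] x) := by
    intro i j hij
    induction j, hij using Nat.le_induction with
    | base => intro _; exact le_rfl
    | succ j hij ih =>
      intro hj
      have := ih (by omega)
      have := hinc j (by omega)
      linarith
  -- The chain returns to the ball around its `i`-th point with a value at least `3 * k` above that
  -- of the `(i + 1)`-st, which was maximal up to `k`.
  obtain ⟨i, j, hij, hj, hdist⟩ := hN fun i => s^[i] x
  have h₁ : u (s^[j] x) ≤ sSup (u '' Metric.ball (s^[i] x) ε) :=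
    le_csSup (hb.bddAbove_image _) ⟨_, hdist, rfl⟩
  have h₂ := hsu (s^[i] x)
  rw [← hsucc] at h₂
  have h₃ := hinc (i + 1) (by omega)
  have h₄ := hmono (i + 2) j hij hj
  have h₅ : s^[i + 1 + 1] x = s^[i + 2] x := rfl
  rw [h₅] at h₃
  linarith

theorem exists_nearly_max (hε : 0 < ε) {k : ℝ} (hk : 0 < k) (x : X) :
    ∃ z ∈ Metric.ball x ε, sSup (u '' Metric.ball x ε) - k ≤ u z := by
  obtain ⟨_, ⟨z, hz, rfl⟩, h⟩ := exists_lt_of_lt_csSup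
    (Set.Nonempty.image u ⟨x, Metric.mem_ball_self hε⟩)
    (sub_lt_self (sSup (u '' Metric.ball x ε)) hk)
  exact ⟨z, hz, h.le⟩

/-- The set `Y` can be reached from every point in a number of steps that does not depend on the
loss `l` allowed in each step. -/
theorem exists_goodReach_eq_univ [CompactSpace X] [PreconnectedSpace X] (hY : Y.Nonempty)
    (hε : 0 < ε) (hp : 0 < p) (hq : 0 < q) (hpq : p + q = 1) (hb : IsBoundedFun u)
    (hu : ∀ x, x ∉ Y →
      u x = p * sSup (u '' Metric.ball x ε) + q * sInf (u '' Metric.ball x ε)) :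
    ∃ L : ℕ, ∀ l : ℝ, 0 < l → goodReach ε Y u l L = Set.univ := by
  obtain ⟨N, hN⟩ := exists_dist_lt_of_compact (X := X) hε
  obtain ⟨n, hn⟩ := exists_reach_eq_univ hε hY
  refine ⟨n + N, fun l hl => ?_⟩
  -- A tolerance fine enough to run the greedy chain from slope `q * l`; only `k`, not `N`, depends
  -- on `l`.
  set k := min l ((q / 2) ^ N * (q * l) / 4) with hkdef
  have hk : 0 < k := lt_min hl (by positivity)
  have hkl : k ≤ l := min_le_left _ _
  have hkb : 4 * k ≤ (q / 2) ^ N * (q * l) := by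
    have : k ≤ (q / 2) ^ N * (q * l) / 4 := min_le_right _ _
    linarith
  choose s hs hsu using exists_nearly_max (u := u) hε hk
  have hiter : ∀ i x, s^[i] x ∈ Y → x ∈ goodReach ε Y u l i := by
    intro i
    induction i with
    | zero => exact fun x h => h
    | succ i ih =>
      intro x h
      rw [Function.iterate_succ_apply] at h
      exact Or.inr ⟨s x, hs x, by have := hsu x; linarith, ih _ h⟩
  have hlarge : ∀ x, q * l ≤ sSup (u '' Metric.ball x ε) - u x → x ∈ goodReach ε Y u l N := by
    intro x hx
    obtain ⟨i, hi, hY'⟩ := exists_iterate_mem hp hq hpq hb hu hN hk hkb hs hsu x hx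
    exact goodReach_mono Y u l hi (hiter i x hY')
  have key : ∀ m, reach ε Y m ⊆ goodReach ε Y u l (m + N) := by
    intro m
    induction m with
    | zero => exact goodReach_mono (ε := ε) Y u l (Nat.zero_le (0 + N))
    | succ m ih =>
      intro x hx
      by_cases hxY : x ∈ Y
      · exact goodReach_mono Y u l (Nat.zero_le (m + 1 + N)) hxY
      -- A steep point switches to the greedy chain, once and for all, at a cost of at most `N`
      -- steps. At a flat point the oscillation of `u` over the ball is below `l`, so the step given
      -- by `reach` is admissible.
      by_cases hxb : q * l ≤ sSup (u '' Metric.ball x ε) - u x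
      · exact goodReach_mono Y u l (Nat.le_add_left N (m + 1)) (hlarge x hxb)
      · obtain ⟨z, hz, hd⟩ := Metric.mem_thickening_iff.1 hx
        rw [dist_comm] at hd
        rw [show m + 1 + N = (m + N) + 1 by omega]
        refine Or.inr ⟨z, hd, ?_, ih hz⟩
        have h₁ := hu x hxY
        have h₂ : sInf (u '' Metric.ball x ε) ≤ u z :=
          csInf_le (hb.bddBelow_image _) ⟨z, hd, rfl⟩
        set S := sSup (u '' Metric.ball x ε)
        set I := sInf (u '' Metric.ball x ε)
        have h₃ : S - u x = q * (S - I) := by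
          have : S = (p + q) * S := by rw [hpq, one_mul]
          linarith
        rw [h₃, not_le] at hxb
        have := lt_of_mul_lt_mul_left hxb hq.le
        linarith
  exact Set.univ_subset_iff.1 (hn ▸ key n)

/-- A bounded harmonic function can be approximated by strict subsolutions which come with an
explicit choice of the moves of player I. -/
theorem exists_strict_subsolution [CompactSpace X] [PreconnectedSpace X] (hY : Y.Nonempty)
    (hε : 0 < ε) (hp : 0 < p) (hq : 0 < q) (hpq : p + q = 1) (hb : IsBoundedFun u)
    (hu : ∀ x, x ∉ Y →
      u x = p * sSup (u '' Metric.ball x ε) + q * sInf (u '' Metric.ball x ε))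
    {c : ℝ} (hc : 0 < c) :
    ∃ (w : X → ℝ) (g : X → X) (l : ℝ), 0 < l ∧ (∀ x, w x ≤ u x) ∧ (∀ x, u x - c ≤ w x) ∧
      (∀ x, dist (g x) x < ε) ∧
      ∀ x, x ∉ Y → ∀ z, dist z x < ε → w x + l ≤ p * w (g x) + q * w z := by
  obtain ⟨L, hL⟩ := exists_goodReach_eq_univ hY hε hp hq hpq hb hu
  -- `L` is fixed before `l`, so `l` can be chosen to make the largest penalty, below `2 * l * A`,
  -- at most `c`.
  set s := p / 2 with hs
  have hs0 : 0 < s := by positivity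
  have hs1 : s ≤ 1 := by rw [hs]; linarith
  set A := (s ^ L)⁻¹ with hA
  have hA0 : 0 < A := by positivity
  set l := c / (2 * A) with hl
  have hl0 : 0 < l := by positivity
  have hlA : 2 * l * A = c := by rw [hl]; field_simp
  have hex : ∀ x, ∃ n, x ∈ goodReach ε Y u l n := fun x => ⟨L, hL l hl0 ▸ Set.mem_univ x⟩
  classical
  set D : X → ℕ := fun x => Nat.find (hex x)
  have hDL : ∀ x, D x ≤ L := fun x => Nat.find_min' (hex x) (hL l hl0 ▸ Set.mem_univ x)
  have hg : ∀ x, ∃ z, dist z x < ε ∧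
      (x ∉ Y → sSup (u '' Metric.ball x ε) - l ≤ u z ∧ D z + 1 ≤ D x) := by
    intro x
    by_cases hx : x ∈ Y
    · exact ⟨x, by simpa using hε, fun h => absurd hx h⟩
    · have hmem : x ∈ goodReach ε Y u l (D x) := Nat.find_spec (hex x)
      obtain ⟨m, hm⟩ : ∃ m, D x = m + 1 := by
        refine Nat.exists_eq_succ_of_ne_zero fun h => ?_
        rw [h] at hmem
        exact hx hmem
      rw [hm] at hmem
      rcases hmem with h | ⟨z, hz, hzu, hzm⟩
      · have : D x ≤ m := Nat.find_min' (hex x) h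
        omega
      · have : D z ≤ m := Nat.find_min' (hex z) hzm
        exact ⟨z, hz, fun _ => ⟨hzu, by omega⟩⟩
  choose g hgd hgu using hg
  have hpow : ∀ n, 0 ≤ s ^ n ∧ s ^ n ≤ 1 := fun n => ⟨by positivity, pow_le_one₀ hs0.le hs1⟩
  -- A winning move of player I lowers `D`, and `s = p / 2` makes `p * s ^ (D x - 1) = 2 * s ^ D x`.
  -- So even if the term of player II's move is discarded, the penalty falls on average by at least
  -- `2 * l * A * s ^ D x ≥ 2 * l`, which covers the loss `p * l ≤ l` and leaves `l`.
  refine ⟨fun x => u x - 2 * l * (A * (1 - s ^ D x)), g, l, hl0, fun x => ?_, fun x => ?_, hgd,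
    fun x hx z hz => ?_⟩
  · have : 0 ≤ 2 * l * (A * (1 - s ^ D x)) := by
      have := (hpow (D x)).2
      have : 0 ≤ 1 - s ^ D x := by linarith
      positivity
    linarith
  · have : 2 * l * (A * (1 - s ^ D x)) ≤ 2 * l * A := by
      have : A * (1 - s ^ D x) ≤ A := mul_le_of_le_one_right hA0.le (by linarith [(hpow (D x)).1])
      have : 0 < 2 * l := by positivity
      gcongr
    linarith
  · obtain ⟨h₁, h₂⟩ := hgu x hx
    have h₃ := hu x hx
    have h₄ : sInf (u '' Metric.ball x ε) ≤ u z := csInf_le (hb.bddBelow_image _) ⟨z, hz, rfl⟩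
    set S := sSup (u '' Metric.ball x ε)
    set I := sInf (u '' Metric.ball x ε)
    obtain ⟨m, hm⟩ : ∃ m, D x = m + 1 := ⟨D x - 1, by omega⟩
    have h₅ : s ^ m ≤ s ^ D (g x) := pow_le_pow_of_le_one hs0.le hs1 (by omega)
    have h₆ : 1 ≤ A * s ^ (m + 1) := by
      have : s ^ L ≤ s ^ (m + 1) := pow_le_pow_of_le_one hs0.le hs1 (hm ▸ hDL x)
      calc 1 = A * s ^ L := by rw [hA, inv_mul_cancel₀ (by positivity)]
        _ ≤ _ := by gcongr
    have h₇ : p * (S - l) ≤ p * u (g x) := by gcongr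
    have h₈ : q * I ≤ q * u z := by gcongr
    have h₉ : p * (A * s ^ m) ≤ p * (A * s ^ D (g x)) := by gcongr
    have h₁₀ : 0 ≤ q * (A * s ^ D z) := by positivity
    have h₁₁ : p * (A * s ^ m) = 2 * (A * s ^ (m + 1)) := by rw [pow_succ, hs]; ring
    have h₁₂ : p * l ≤ l := mul_le_of_le_one_left hl0.le (by linarith)
    have h₁₃ : 1 + A * s ^ (m + 1) ≤ p * (A * s ^ D (g x)) + q * (A * s ^ D z) := by linarith
    have h₁₄ : 2 * l * (1 + A * s ^ (m + 1)) ≤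
        2 * l * (p * (A * s ^ D (g x)) + q * (A * s ^ D z)) := by gcongr
    have hq' : q = 1 - p := by linarith
    subst hq'
    beta_reduce
    rw [hm]
    linarith

end Harmonic

end TugOfWar

namespace TugOfWar

/-! ### Functions of finitely many coin tosses -/

section Coins

open ProbabilityTheory

variable {θ : ℝ}

/-- Such a function factors through a finite discrete space; hence strategies need no measurability.
-/
theorem measurable_of_dependsOn {β : Type*} [MeasurableSpace β] {f : (ℕ → Bool) → β} {n : ℕ}
    (hf : DependsOn f (Finset.range n : Set ℕ)) : Measurable f := by
  have : Nonempty β := ⟨f fun _ => true⟩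
  obtain ⟨g, rfl⟩ := dependsOn_iff_exists_comp.1 hf
  exact (measurable_of_countable g).comp (by fun_prop)

/-- A bounded function of the first tosses and a function of the next toss are independent. -/
theorem integral_coinTosses_mul (h₁ : -1 ≤ θ) (h₂ : θ ≤ 1) {n : ℕ} {f : (ℕ → Bool) → ℝ}
    (hf : DependsOn f (Finset.range n : Set ℕ)) (c : Bool → ℝ) :
    ∫ ω, f ω * c (ω n) ∂coinTosses θ =
      (∫ ω, f ω ∂coinTosses θ) * ((1 + θ) / 2 * c true + (1 - θ) / 2 * c false) := by
  set ν : Measure Bool := ENNReal.ofReal ((1 + θ) / 2) • Measure.dirac true +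
    ENNReal.ofReal ((1 - θ) / 2) • Measure.dirac false with hν
  have hprob : IsProbabilityMeasure ν := by
    constructor
    simp only [hν, Measure.coe_add, Measure.coe_smul, Pi.add_apply, Pi.smul_apply, measure_univ,
      smul_eq_mul, mul_one]
    rw [← ENNReal.ofReal_add (by linarith) (by linarith)]
    ring_nf
    simp
  have hμ : coinTosses θ = Measure.infinitePi fun _ : ℕ => ν := rfl
  have hind : iIndepFun (fun (i : ℕ) (ω : ℕ → Bool) => ω i) (coinTosses θ) := by
    rw [hμ]
    exact iIndepFun_infinitePi (X := fun _ b => b) fun _ => measurable_id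
  obtain ⟨g, hg⟩ := dependsOn_iff_exists_comp.1 hf
  have hind' := hind.indepFun_finset (Finset.range n) {n} (by simp) fun i => measurable_pi_apply i
  have hind'' := hind'.comp (φ := fun a => g a) (ψ := fun a => c (a ⟨n, by simp⟩))
    (measurable_of_countable _) (measurable_of_countable _)
  have hmf := measurable_of_dependsOn hf
  have hfg : (fun a => g a) ∘ (fun (a : ℕ → Bool) (i : Finset.range n) => a i) = f := by
    rw [hg]; rfl
  rw [hfg] at hind''
  have hmc : Measurable fun ω : ℕ → Bool => c (ω n) :=
    (measurable_of_countable c).comp (measurable_pi_apply n)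
  have hmul := hind''.integral_fun_mul_eq_mul_integral hmf.aestronglyMeasurable
    hmc.aestronglyMeasurable
  have hc : ∫ ω, c (ω n) ∂coinTosses θ = (1 + θ) / 2 * c true + (1 - θ) / 2 * c false := by
    have hmap := (measurePreserving_eval_infinitePi (fun _ : ℕ => ν) n).map_eq
    have : ∫ ω, c (ω n) ∂coinTosses θ = ∫ b, c b ∂ν := by
      rw [← hmap, integral_map (measurable_pi_apply n).aemeasurable
        (measurable_of_countable c).aestronglyMeasurable, hμ]
    rw [this, hν, integral_add_measure, integral_smul_measure, integral_smul_measure,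
      integral_dirac, integral_dirac, ENNReal.toReal_ofReal (by linarith),
      ENNReal.toReal_ofReal (by linarith), smul_eq_mul, smul_eq_mul]
    · exact (integrable_dirac (by simp)).smul_measure ENNReal.ofReal_ne_top
    · exact (integrable_dirac (by simp)).smul_measure ENNReal.ofReal_ne_top
  rw [← hc]
  exact hmul

end Coins

/-! ### The stopped game -/

section Play

variable {X : Type*} [MetricSpace X] {ε : ℝ} {Y : Set X} (S₁ S₂ : Strategy X ε) (x₀ : X)

theorem playHistory_dependsOn (n : ℕ) :
    DependsOn (fun ω => playHistory S₁ S₂ x₀ ω n) (Finset.range n : Set ℕ) := by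
  induction n with
  | zero => intro ω ω' _; rfl
  | succ n ih =>
    intro ω ω' h
    have h₁ : playHistory S₁ S₂ x₀ ω n = playHistory S₁ S₂ x₀ ω' n :=
      ih fun i hi => h i (by simp at hi ⊢; omega)
    have h₂ : ω n = ω' n := h n (by simp)
    simp only [playHistory, h₁, h₂]

theorem gamePosition_succ (ω : ℕ → Bool) (n : ℕ) :
    gamePosition S₁ S₂ x₀ ω (n + 1) =
      if ω n = true then S₁.move x₀ (playHistory S₁ S₂ x₀ ω n)
      else S₂.move x₀ (playHistory S₁ S₂ x₀ ω n) := rfl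

/-- The game has not ended after `n` rounds. -/
def Running (Y : Set X) (ω : ℕ → Bool) (n : ℕ) : Prop :=
  ∀ k ≤ n, gamePosition S₁ S₂ x₀ ω k ∉ Y

theorem gamePosition_dependsOn {k n : ℕ} (hk : k ≤ n) :
    DependsOn (fun ω => gamePosition S₁ S₂ x₀ ω k) (Finset.range n : Set ℕ) := by
  intro ω ω' h
  have h₁ : playHistory S₁ S₂ x₀ ω k = playHistory S₁ S₂ x₀ ω' k :=
    playHistory_dependsOn S₁ S₂ x₀ k fun i hi => h i (by simp at hi ⊢; omega)
  simp only [gamePosition, h₁]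

theorem running_dependsOn (Y : Set X) (n : ℕ) :
    DependsOn (fun ω => Running S₁ S₂ x₀ Y ω n) (Finset.range n : Set ℕ) := by
  intro ω ω' h
  refine propext (forall₂_congr fun k hk => ?_)
  have : gamePosition S₁ S₂ x₀ ω k = gamePosition S₁ S₂ x₀ ω' k :=
    gamePosition_dependsOn S₁ S₂ x₀ hk h
  rw [this]

open Classical in
/-- The value of `w` at the position after `n` rounds or at the final position of the game,
whichever comes first. -/
noncomputable def stoppedValue (Y : Set X) (w : X → ℝ) (ω : ℕ → Bool) : ℕ → ℝ
  | 0 => w x₀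
  | n + 1 =>
    if Running S₁ S₂ x₀ Y ω n then w (gamePosition S₁ S₂ x₀ ω (n + 1))
    else stoppedValue Y w ω n

open Classical in
theorem stoppedValue_dependsOn (Y : Set X) (w : X → ℝ) (n : ℕ) :
    DependsOn (fun ω => stoppedValue S₁ S₂ x₀ Y w ω n) (Finset.range n : Set ℕ) := by
  induction n with
  | zero => intro ω ω' _; rfl
  | succ n ih =>
    intro ω ω' h
    have hn : ∀ i ∈ (Finset.range n : Set ℕ), ω i = ω' i :=
      fun i hi => h i (by simp at hi ⊢; omega)
    have h₁ : stoppedValue S₁ S₂ x₀ Y w ω n = stoppedValue S₁ S₂ x₀ Y w ω' n := ih hn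
    have h₂ : Running S₁ S₂ x₀ Y ω n = Running S₁ S₂ x₀ Y ω' n :=
      running_dependsOn S₁ S₂ x₀ Y n hn
    have h₃ : gamePosition S₁ S₂ x₀ ω (n + 1) = gamePosition S₁ S₂ x₀ ω' (n + 1) :=
      gamePosition_dependsOn S₁ S₂ x₀ le_rfl h
    simp only [stoppedValue, h₁, h₃]
    exact if_congr (iff_of_eq h₂) rfl rfl

variable {S₁ S₂ x₀}

theorem stoppedValue_of_running {w : X → ℝ} {ω : ℕ → Bool} {n : ℕ}
    (h : Running S₁ S₂ x₀ Y ω n) :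
    stoppedValue S₁ S₂ x₀ Y w ω n = w (gamePosition S₁ S₂ x₀ ω n) := by
  cases n with
  | zero => rfl
  | succ n => exact if_pos fun k hk => h k (by omega)

open Classical in
theorem stoppedValue_of_not_running {w : X → ℝ} {ω : ℕ → Bool} {n : ℕ}
    (h : ¬ Running S₁ S₂ x₀ Y ω n) (he : GameEnds Y S₁ S₂ x₀ ω) :
    stoppedValue S₁ S₂ x₀ Y w ω n = w (gamePosition S₁ S₂ x₀ ω (Nat.find he)) := by
  induction n with
  | zero =>
    have : Nat.find he = 0 := by
      refine (Nat.find_eq_zero he).2 ?_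
      simpa [Running] using h
    rw [this]
    rfl
  | succ n ih =>
    by_cases hn : Running S₁ S₂ x₀ Y ω n
    · have : Nat.find he = n + 1 := by
        refine (Nat.find_eq_iff he).2 ⟨?_, fun k hk => hn k (by omega)⟩
        by_contra hY
        refine h fun k hk => ?_
        rcases Nat.lt_or_ge n k with h' | h'
        · rwa [show k = n + 1 by omega]
        · exact hn k h'
      rw [this]
      exact if_pos hn
    · exact (if_neg hn).trans (ih hn)

theorem gameEnds_of_not_running {ω : ℕ → Bool} {n : ℕ} (h : ¬ Running S₁ S₂ x₀ Y ω n) :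
    GameEnds Y S₁ S₂ x₀ ω := by
  simp only [Running, not_forall, not_not] at h
  obtain ⟨k, -, hk⟩ := h
  exact ⟨k, hk⟩

theorem abs_stoppedValue_le {w : X → ℝ} {C : ℝ} (hw : ∀ x, |w x| ≤ C) (ω : ℕ → Bool) (n : ℕ) :
    |stoppedValue S₁ S₂ x₀ Y w ω n| ≤ C := by
  induction n with
  | zero => exact hw _
  | succ n ih =>
    rw [stoppedValue]
    split_ifs
    · exact hw _
    · exact ih

theorem payment_of_not_running {F : Y → ℝ} {f : X → ℝ} (hf : ∀ y : Y, f y = F y)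
    {ω : ℕ → Bool} {n : ℕ} (h : ¬ Running S₁ S₂ x₀ Y ω n) :
    payment F S₁ S₂ x₀ ω = stoppedValue S₁ S₂ x₀ Y f ω n := by
  have he := gameEnds_of_not_running h
  rw [stoppedValue_of_not_running h he, payment, dif_pos he, ← hf]

/-- The payment is the pointwise limit of stopped values of `F` extended by zero; in a game that
never ends, these are `0`, the default payment. -/
theorem measurable_payment (F : Y → ℝ) : Measurable (payment F S₁ S₂ x₀) := by
  classical
  set f : X → ℝ := fun x => if h : x ∈ Y then F ⟨x, h⟩ else 0 with hfdef
  have hf : ∀ y : Y, f y = F y := fun y => by simp [hfdef]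
  refine measurable_of_tendsto_metrizable
    (fun n => measurable_of_dependsOn (stoppedValue_dependsOn S₁ S₂ x₀ Y f n))
    (tendsto_pi_nhds.2 fun ω => tendsto_const_nhds.congr' ?_)
  by_cases he : GameEnds Y S₁ S₂ x₀ ω
  · obtain ⟨k, hk⟩ := he
    filter_upwards [Filter.eventually_ge_atTop k] with n hn
    exact payment_of_not_running hf fun h => h k hn hk
  · refine Filter.Eventually.of_forall fun n => ?_
    have hr : Running S₁ S₂ x₀ Y ω n := fun k _ hk => he ⟨k, hk⟩
    beta_reduce
    rw [stoppedValue_of_running hr, payment, dif_neg he, hfdef]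
    have hn : gamePosition S₁ S₂ x₀ ω n ∉ Y := hr n le_rfl
    simp [hn]

theorem abs_payment_le {F : Y → ℝ} {C : ℝ} (hC : 0 ≤ C) (hF : ∀ y, |F y| ≤ C) (ω : ℕ → Bool) :
    |payment F S₁ S₂ x₀ ω| ≤ C := by
  rw [payment]
  split_ifs
  · exact hF _
  · simpa using hC

end Play

end TugOfWar

namespace TugOfWar

theorem integrable_of_dependsOn {μ : Measure (ℕ → Bool)} [IsFiniteMeasure μ]
    {f : (ℕ → Bool) → ℝ} {n : ℕ} (hf : DependsOn f (Finset.range n : Set ℕ)) :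
    Integrable f μ := by
  obtain ⟨g, hg⟩ := dependsOn_iff_exists_comp.1 hf
  obtain ⟨C, hC⟩ := (Set.finite_range fun a => ‖g a‖).bddAbove
  refine Integrable.of_bound (measurable_of_dependsOn hf).aestronglyMeasurable C
    (Filter.Eventually.of_forall fun ω => ?_)
  rw [hg]
  exact hC ⟨_, rfl⟩

theorem dependsOn_range_mono {β : Type*} {f : (ℕ → Bool) → β} {m n : ℕ} (hmn : m ≤ n)
    (hf : DependsOn f (Finset.range m : Set ℕ)) : DependsOn f (Finset.range n : Set ℕ) :=
  fun _ _ h => hf fun i hi => h i (by simp at hi ⊢; omega)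

/-! ### Drift, termination and expected payment -/

section Game

variable {X : Type*} [MetricSpace X] {ε : ℝ} {Y : Set X} {S₁ S₂ : Strategy X ε} {x₀ : X}
  {w : X → ℝ} {θ l : ℝ}

/-- Given the first `n` tosses, both candidate moves are determined and the next toss is independent
of them, so the expected increment is the weighted average in `hstep`. -/
theorem integral_stoppedValue_succ (h₁ : -1 ≤ θ) (h₂ : θ ≤ 1)
    (hstep : ∀ h : History X, currentPosition x₀ h ∉ Y →
      w (currentPosition x₀ h) + l ≤
        (1 + θ) / 2 * w (S₁.move x₀ h) + (1 - θ) / 2 * w (S₂.move x₀ h)) (n : ℕ) :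
    ∫ ω, stoppedValue S₁ S₂ x₀ Y w ω n ∂coinTosses θ +
        l * (coinTosses θ).real {ω | Running S₁ S₂ x₀ Y ω n} ≤
      ∫ ω, stoppedValue S₁ S₂ x₀ Y w ω (n + 1) ∂coinTosses θ := by
  classical
  have := isProbabilityMeasure_coinTosses h₁ h₂
  set μ := coinTosses θ with hμ
  -- The increment that would occur if the user of `S` won the next toss.
  set A : Strategy X ε → (ℕ → Bool) → ℝ := fun S ω =>
    if Running S₁ S₂ x₀ Y ω n then
      w (S.move x₀ (playHistory S₁ S₂ x₀ ω n)) - w (gamePosition S₁ S₂ x₀ ω n)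
    else 0 with hA
  have hAd : ∀ S, DependsOn (A S) (Finset.range n : Set ℕ) := by
    intro S ω ω' h
    have e₁ : playHistory S₁ S₂ x₀ ω n = playHistory S₁ S₂ x₀ ω' n :=
      playHistory_dependsOn S₁ S₂ x₀ n h
    have e₂ : Running S₁ S₂ x₀ Y ω n = Running S₁ S₂ x₀ Y ω' n :=
      running_dependsOn S₁ S₂ x₀ Y n h
    simp only [hA, e₁, gamePosition]
    exact if_congr (iff_of_eq e₂) rfl rfl
  have hAc : ∀ S (c : Bool → ℝ),
      DependsOn (fun ω => A S ω * c (ω n)) (Finset.range (n + 1) : Set ℕ) := by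
    intro S c ω ω' h
    have e₁ : A S ω = A S ω' := dependsOn_range_mono n.le_succ (hAd S) h
    have e₂ : ω n = ω' n := h n (by simp)
    simp only [e₁, e₂]
  obtain ⟨c₁, hc₁⟩ : ∃ c : Bool → ℝ, c = fun b => if b = true then 1 else 0 := ⟨_, rfl⟩
  obtain ⟨c₂, hc₂⟩ : ∃ c : Bool → ℝ, c = fun b => if b = true then 0 else 1 := ⟨_, rfl⟩
  have hdecomp : ∀ ω, stoppedValue S₁ S₂ x₀ Y w ω (n + 1) = stoppedValue S₁ S₂ x₀ Y w ω n +
      (A S₁ ω * c₁ (ω n) + A S₂ ω * c₂ (ω n)) := by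
    intro ω
    by_cases hr : Running S₁ S₂ x₀ Y ω n
    · rw [stoppedValue, if_pos hr, stoppedValue_of_running hr, gamePosition_succ]
      simp only [hA, if_pos hr]
      cases ω n <;> simp [hc₁, hc₂]
    · rw [stoppedValue, if_neg hr]
      simp only [hA, if_neg hr]
      simp
  have hmeas : MeasurableSet {ω | Running S₁ S₂ x₀ Y ω n} :=
    measurableSet_setOfPred.2 (measurable_of_dependsOn (running_dependsOn S₁ S₂ x₀ Y n))
  have hle : l * μ.real {ω | Running S₁ S₂ x₀ Y ω n} ≤
      ∫ ω, (A S₁ ω * ((1 + θ) / 2) + A S₂ ω * ((1 - θ) / 2)) ∂μ := by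
    rw [← integral_indicator_one hmeas, ← integral_const_mul]
    refine integral_mono (((integrable_const 1).indicator hmeas).const_mul l)
      (((integrable_of_dependsOn (hAd S₁)).mul_const _).add
        ((integrable_of_dependsOn (hAd S₂)).mul_const _)) fun ω => ?_
    by_cases hr : Running S₁ S₂ x₀ Y ω n
    · have := hstep (playHistory S₁ S₂ x₀ ω n) (hr n le_rfl)
      simp only [hA, if_pos hr]
      rw [Set.indicator_of_mem (by exact hr)]
      simp only [gamePosition, Pi.one_apply]
      linarith
    · simp only [hA, if_neg hr]
      rw [Set.indicator_of_notMem (by exact hr)]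
      simp
  have hint : Integrable (fun ω => A S₁ ω * c₁ (ω n) + A S₂ ω * c₂ (ω n)) μ :=
    (integrable_of_dependsOn (hAc S₁ c₁)).add (integrable_of_dependsOn (hAc S₂ c₂))
  rw [integral_congr_ae (Filter.Eventually.of_forall hdecomp), integral_add (integrable_of_dependsOn (stoppedValue_dependsOn S₁ S₂ x₀ Y w n))
      hint,
    integral_add (integrable_of_dependsOn (hAc S₁ c₁)) (integrable_of_dependsOn (hAc S₂ c₂)),
    integral_coinTosses_mul h₁ h₂ (hAd S₁), integral_coinTosses_mul h₁ h₂ (hAd S₂)]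
  rw [integral_add ((integrable_of_dependsOn (hAd S₁)).mul_const _)
    ((integrable_of_dependsOn (hAd S₂)).mul_const _), integral_mul_const,
    integral_mul_const] at hle
  simp only [hc₁, hc₂, if_true, Bool.false_eq_true, if_false, mul_one, mul_zero, add_zero, zero_add]
  linarith

/-- If a bounded function lies below the terminal payoff and increases on average by a definite
amount in each round, then the game ends almost surely and the expected payment is at least the
value of the function at the starting point. -/
theorem endsAlmostSurely_and_le_expectedPayment (h₁ : -1 ≤ θ) (h₂ : θ ≤ 1) {F : Y → ℝ} {C : ℝ}
    (hC : 0 ≤ C) (hF : ∀ y, |F y| ≤ C) (hw : ∀ x, |w x| ≤ C) (hwF : ∀ y : Y, w y ≤ F y)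
    (hl : 0 < l)
    (hstep : ∀ h : History X, currentPosition x₀ h ∉ Y →
      w (currentPosition x₀ h) + l ≤
        (1 + θ) / 2 * w (S₁.move x₀ h) + (1 - θ) / 2 * w (S₂.move x₀ h)) :
    EndsAlmostSurely Y θ S₁ S₂ x₀ ∧ w x₀ ≤ expectedPayment F θ S₁ S₂ x₀ := by
  classical
  have := isProbabilityMeasure_coinTosses h₁ h₂
  set μ := coinTosses θ with hμ
  set r : ℕ → ℝ := fun n => μ.real {ω | Running S₁ S₂ x₀ Y ω n} with hr
  have hr0 : ∀ n, 0 ≤ r n := fun n => measureReal_nonneg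
  have hanti : Antitone r := fun m n hmn =>
    measureReal_mono fun ω h k hk => h k (hk.trans hmn)
  have hsum : ∀ n : ℕ, w x₀ + l * (n * r n) ≤
      ∫ ω, stoppedValue S₁ S₂ x₀ Y w ω n ∂μ := by
    have hsum' : ∀ n : ℕ, w x₀ + l * ∑ k ∈ Finset.range n, r k ≤
        ∫ ω, stoppedValue S₁ S₂ x₀ Y w ω n ∂μ := by
      intro n
      induction n with
      | zero => simp [stoppedValue]
      | succ n ih =>
        have := integral_stoppedValue_succ h₁ h₂ hstep n
        rw [Finset.sum_range_succ]
        simp only [hr] at ih ⊢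
        linarith
    intro n
    refine le_trans ?_ (hsum' n)
    have : n * r n ≤ ∑ k ∈ Finset.range n, r k := by
      have := Finset.card_nsmul_le_sum (Finset.range n) r (r n)
        fun k hk => hanti (Finset.mem_range.1 hk).le
      simpa using this
    gcongr
  have hub : ∀ n, ∫ ω, stoppedValue S₁ S₂ x₀ Y w ω n ∂μ ≤ C := by
    intro n
    calc ∫ ω, stoppedValue S₁ S₂ x₀ Y w ω n ∂μ ≤ ∫ _, C ∂μ :=
          integral_mono (integrable_of_dependsOn (stoppedValue_dependsOn S₁ S₂ x₀ Y w n))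
            (integrable_const C) fun ω => (abs_le.1 (abs_stoppedValue_le hw ω n)).2
      _ = C := by simp
  -- The accumulated drift `l * (n * r n)` cannot exceed `2 * C`, so `r n` is of order `1 / n`.
  have hr_lim : Filter.Tendsto r Filter.atTop (nhds 0) := by
    have hlim : Filter.Tendsto (fun n : ℕ => 2 * C / l / (n : ℝ)) Filter.atTop (nhds 0) :=
      tendsto_const_div_atTop_nhds_zero_nat _
    refine squeeze_zero' (Filter.Eventually.of_forall hr0) ?_ hlim
    filter_upwards [Filter.eventually_gt_atTop 0] with n hn
    have hn' : (0 : ℝ) < n := by exact_mod_cast hn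
    have e₁ := hsum n
    have e₂ := hub n
    have e₃ := (abs_le.1 (hw x₀)).1
    rw [le_div_iff₀ hn', le_div_iff₀ hl]
    linarith
  have hends : EndsAlmostSurely Y θ S₁ S₂ x₀ := by
    have hle : ∀ n, μ.real {ω | ¬ GameEnds Y S₁ S₂ x₀ ω} ≤ r n := fun n =>
      measureReal_mono fun ω h k _ hk => h ⟨k, hk⟩
    have h0 : μ.real {ω | ¬ GameEnds Y S₁ S₂ x₀ ω} = 0 :=
      le_antisymm (ge_of_tendsto' hr_lim hle) measureReal_nonneg
    rwa [measureReal_eq_zero_iff] at h0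
  refine ⟨hends, ?_⟩
  -- Once the game has ended, the payment dominates the stopped value; before that, the two differ
  -- by at most `2 * C`.
  have hpay : ∀ n, w x₀ - 2 * C * r n ≤ expectedPayment F θ S₁ S₂ x₀ := by
    intro n
    have hmeas : MeasurableSet {ω | Running S₁ S₂ x₀ Y ω n} :=
      measurableSet_setOfPred.2 (measurable_of_dependsOn (running_dependsOn S₁ S₂ x₀ Y n))
    have hint := integrable_of_dependsOn (μ := μ) (stoppedValue_dependsOn S₁ S₂ x₀ Y w n)
    have hind : Integrable ({ω | Running S₁ S₂ x₀ Y ω n}.indicator (1 : (ℕ → Bool) → ℝ)) μ :=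
      (integrable_const 1).indicator hmeas
    have key : ∫ ω, (stoppedValue S₁ S₂ x₀ Y w ω n -
        2 * C * {ω | Running S₁ S₂ x₀ Y ω n}.indicator (1 : (ℕ → Bool) → ℝ) ω) ∂μ ≤
        expectedPayment F θ S₁ S₂ x₀ := by
      refine integral_mono (hint.sub (hind.const_mul _))
        (Integrable.of_bound (measurable_payment F).aestronglyMeasurable C
          (Filter.Eventually.of_forall fun ω => abs_payment_le hC hF ω)) fun ω => ?_
      by_cases hrun : Running S₁ S₂ x₀ Y ω n
      · have e₁ := (abs_le.1 (abs_stoppedValue_le (S₁ := S₁) (S₂ := S₂) (x₀ := x₀) (Y := Y)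
          hw ω n)).2
        have e₂ := (abs_le.1 (abs_payment_le (S₁ := S₁) (S₂ := S₂) (x₀ := x₀) hC hF ω)).1
        beta_reduce
        rw [Set.indicator_of_mem (by exact hrun), Pi.one_apply]
        linarith
      · have he := gameEnds_of_not_running hrun
        beta_reduce
        rw [Set.indicator_of_notMem (by exact hrun), stoppedValue_of_not_running hrun he,
          payment, dif_pos he, mul_zero, sub_zero]
        exact hwF ⟨_, Nat.find_spec he⟩
    rw [integral_sub hint (hind.const_mul _), integral_const_mul,
      integral_indicator_one hmeas] at key
    have e₁ := hsum n
    have e₂ : 0 ≤ l * (n * r n) := by have := hr0 n; positivity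
    simp only [hr] at e₁ e₂ ⊢
    linarith
  have hlim : Filter.Tendsto (fun n => w x₀ - 2 * C * r n) Filter.atTop (nhds (w x₀)) := by
    simpa using (hr_lim.const_mul (2 * C)).const_sub (w x₀)
  exact le_of_tendsto' hlim hpay

theorem expectedPayment_neg (F : Y → ℝ) :
    expectedPayment (fun y => -F y) θ S₁ S₂ x₀ = -expectedPayment F θ S₁ S₂ x₀ := by
  rw [expectedPayment, expectedPayment, ← integral_neg]
  refine integral_congr_ae (Filter.Eventually.of_forall fun ω => ?_)
  simp only [payment]
  split_ifs <;> simp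

/-! ### Comparison of the values with harmonic functions -/

variable [CompactSpace X] [PreconnectedSpace X]

/-- The stationary strategy given by a map which moves each point by less than `ε`. -/
def stationaryStrategy (g : X → X) (hg : ∀ x, dist (g x) x < ε) : Strategy X ε where
  move x₀ h := g (currentPosition x₀ h)
  dist_move_lt _ _ := hg _

theorem le_valueI (hY : Y.Nonempty) (hε : 0 < ε) (h₁ : -1 < θ) (h₂ : θ < 1) {F : Y → ℝ}
    {u : X → ℝ} (hb : IsBoundedFun u) (hu : IsInfinityHarmonic Y ε θ u)
    (huF : ∀ y : Y, u y = F y) (x : X) : (u x : EReal) ≤ valueI F ε θ x := by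
  have hp : 0 < (1 + θ) / 2 := by linarith
  have hq : 0 < (1 - θ) / 2 := by linarith
  -- Player I need only guarantee each real `a < u x`; the slack `u x - a` serves as `c`, and also
  -- enlarges the bound `C` to cover `w`.
  refine EReal.ge_of_forall_gt_iff_ge.1 fun a ha => ?_
  have ha' : a < u x := by exact_mod_cast ha
  obtain ⟨w, g, l, hl, hwu, huw, hg, hstep⟩ := exists_strict_subsolution hY hε hp hq (by ring) hb hu
    (sub_pos.2 ha')
  obtain ⟨C, hC⟩ := hb
  have hC0 : 0 ≤ C := (abs_nonneg _).trans (hC x)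
  rw [valueI]
  refine le_iSup_of_le (stationaryStrategy g hg) (le_iInf fun S₂ => ?_)
  obtain ⟨he, hle⟩ := endsAlmostSurely_and_le_expectedPayment (S₁ := stationaryStrategy g hg)
    (S₂ := S₂) (x₀ := x) (F := F) (w := w) h₁.le h₂.le (C := C + (u x - a)) (by linarith)
    (fun y => by rw [← huF]; linarith [hC y])
    (fun z => by
      have e₁ := abs_le.1 (hC z)
      have e₂ := hwu z
      have e₃ := huw z
      exact abs_le.2 ⟨by linarith, by linarith⟩)
    (fun y => (hwu y).trans_eq (huF y)) hl
    (fun h hh => hstep _ hh _ (S₂.dist_move_lt x h))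
  rw [payoffMinus, if_pos he, EReal.coe_le_coe_iff]
  have := huw x
  linarith

/-- Negation exchanges supremum and infimum, so `-u` is harmonic for the exchanged weights and
player II acts as the maximizer of `-F`. -/
theorem valueII_le (hY : Y.Nonempty) (hε : 0 < ε) (h₁ : -1 < θ) (h₂ : θ < 1) {F : Y → ℝ}
    {u : X → ℝ} (hb : IsBoundedFun u) (hu : IsInfinityHarmonic Y ε θ u)
    (huF : ∀ y : Y, u y = F y) (x : X) : valueII F ε θ x ≤ (u x : EReal) := by
  have hp : 0 < (1 + θ) / 2 := by linarith
  have hq : 0 < (1 - θ) / 2 := by linarith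
  refine EReal.le_of_forall_lt_iff_le.1 fun a ha => ?_
  have ha' : u x < a := by exact_mod_cast ha
  have hneg : ∀ x, (fun x => -u x) '' Metric.ball x ε = -(u '' Metric.ball x ε) := fun x => by
    rw [← Set.image_neg_eq_neg, Set.image_image]
  obtain ⟨w, g, l, hl, hwu, huw, hg, hstep⟩ := exists_strict_subsolution (u := fun x => -u x)
    hY hε hq hp (by ring) hb.neg
    (fun x hx => by
      rw [hneg, Real.sSup_neg, Real.sInf_neg, hu x hx]
      ring)
    (sub_pos.2 ha')
  obtain ⟨C, hC⟩ := hb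
  have hC0 : 0 ≤ C := (abs_nonneg _).trans (hC x)
  rw [valueII]
  refine iInf_le_of_le (stationaryStrategy g hg) (iSup_le fun S₁ => ?_)
  obtain ⟨he, hle⟩ := endsAlmostSurely_and_le_expectedPayment (S₁ := S₁)
    (S₂ := stationaryStrategy g hg) (x₀ := x) (F := fun y => -F y) (w := w) h₁.le h₂.le
    (C := C + (a - u x)) (by linarith)
    (fun y => by rw [← huF, abs_neg]; linarith [hC y])
    (fun z => by
      have e₁ := abs_le.1 (hC z)
      have e₂ := hwu z
      have e₃ := huw z
      exact abs_le.2 ⟨by linarith, by linarith⟩)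
    (fun y => by rw [← huF]; exact hwu y) hl
    (fun h hh => by
      rw [add_comm ((1 + θ) / 2 * _)]
      exact hstep _ hh _ (S₁.dist_move_lt x h))
  rw [expectedPayment_neg] at hle
  rw [payoffPlus, if_pos he, EReal.coe_le_coe_iff]
  have := huw x
  linarith

end Game

/-- Beyond the usual minimax inequality, the conventions for games that may not end only help: `⊥ ≤
⊤`. -/
theorem valueI_le_valueII {X : Type*} [MetricSpace X] {Y : Set X} (F : Y → ℝ) (ε θ : ℝ) (x : X) :
    valueI F ε θ x ≤ valueII F ε θ x := by
  refine (iSup_iInf_le_iInf_iSup _).trans (iInf_mono fun S₂ => iSup_mono fun S₁ => ?_)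
  rw [payoffMinus, payoffPlus]
  split_ifs
  · exact le_rfl
  · exact bot_le

/-! ### Existence of a bounded harmonic function -/

/-- The least bounded supersolution is harmonic. -/
theorem exists_isInfinityHarmonic {X : Type*} [MetricSpace X] {Y : Set X} {F : Y → ℝ} {C : ℝ}
    (hC : 0 ≤ C) (hF : ∀ y, |F y| ≤ C) {ε θ : ℝ} (hε : 0 < ε) (h₁ : -1 ≤ θ) (h₂ : θ ≤ 1) :
    ∃ u : X → ℝ, IsBoundedFun u ∧ IsInfinityHarmonic Y ε θ u ∧ ∀ y : Y, u y = F y := by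
  classical
  have hp : 0 ≤ (1 + θ) / 2 := by linarith
  have hq : 0 ≤ (1 - θ) / 2 := by linarith
  set T : (X → ℝ) → X → ℝ := fun v x => if hx : x ∈ Y then F ⟨x, hx⟩ else
    (1 + θ) / 2 * sSup (v '' Metric.ball x ε) + (1 - θ) / 2 * sInf (v '' Metric.ball x ε) with hT
  have hne : ∀ (v : X → ℝ) x, (v '' Metric.ball x ε).Nonempty := fun v x =>
    Set.Nonempty.image v ⟨x, Metric.mem_ball_self hε⟩
  have hbd : ∀ v : X → ℝ, (∀ x, |v x| ≤ C) → IsBoundedFun v := fun v hv => ⟨C, hv⟩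
  have hTmono : ∀ v v' : X → ℝ, (∀ x, |v x| ≤ C) → (∀ x, |v' x| ≤ C) → (∀ x, v x ≤ v' x) →
      ∀ x, T v x ≤ T v' x := by
    intro v v' hv hv' hle x
    simp only [hT]
    split_ifs
    · exact le_rfl
    · have e₁ : sSup (v '' Metric.ball x ε) ≤ sSup (v' '' Metric.ball x ε) := by
        refine csSup_le (hne v x) ?_
        rintro _ ⟨z, hz, rfl⟩
        exact (hle z).trans (le_csSup ((hbd v' hv').bddAbove_image _) ⟨z, hz, rfl⟩)
      have e₂ : sInf (v '' Metric.ball x ε) ≤ sInf (v' '' Metric.ball x ε) := by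
        refine le_csInf (hne v' x) ?_
        rintro _ ⟨z, hz, rfl⟩
        exact (csInf_le ((hbd v hv).bddBelow_image _) ⟨z, hz, rfl⟩).trans (hle z)
      gcongr
  have hTbd : ∀ v : X → ℝ, (∀ x, |v x| ≤ C) → ∀ x, |T v x| ≤ C := by
    intro v hv x
    simp only [hT]
    split_ifs
    · exact hF _
    · have e₁ := le_csSup ((hbd v hv).bddAbove_image _)
        (Set.mem_image_of_mem v (Metric.mem_ball_self (x := x) hε))
      have e₂ := csInf_le ((hbd v hv).bddBelow_image _)
        (Set.mem_image_of_mem v (Metric.mem_ball_self (x := x) hε))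
      have e₃ : sSup (v '' Metric.ball x ε) ≤ C :=
        csSup_le (hne v x) (by rintro _ ⟨z, -, rfl⟩; exact (abs_le.1 (hv z)).2)
      have e₄ : -C ≤ sInf (v '' Metric.ball x ε) :=
        le_csInf (hne v x) (by rintro _ ⟨z, -, rfl⟩; exact (abs_le.1 (hv z)).1)
      set S := sSup (v '' Metric.ball x ε)
      set I := sInf (v '' Metric.ball x ε)
      have e₅ : (1 + θ) / 2 * S ≤ (1 + θ) / 2 * C := by gcongr
      have e₆ : (1 - θ) / 2 * I ≤ (1 - θ) / 2 * C := by gcongr; linarith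
      have e₇ : (1 + θ) / 2 * -C ≤ (1 + θ) / 2 * S := by gcongr; linarith
      have e₈ : (1 - θ) / 2 * -C ≤ (1 - θ) / 2 * I := by gcongr
      exact abs_le.2 ⟨by linarith, by linarith⟩
  -- The bound `C` keeps all suprema and infima genuine, and the constant `C` shows that `P` is
  -- nonempty.
  set P : Set (X → ℝ) := {v | (∀ x, |v x| ≤ C) ∧ ∀ x, T v x ≤ v x} with hP
  have hPne : (fun _ => C) ∈ P :=
    ⟨fun _ => (abs_of_nonneg hC).le, fun x =>
      (abs_le.1 (hTbd _ (fun _ => (abs_of_nonneg hC).le) x)).2⟩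
  set u : X → ℝ := fun x => sInf ((fun v : X → ℝ => v x) '' P) with hu
  have hbdd : ∀ x, BddBelow ((fun v : X → ℝ => v x) '' P) := fun x =>
    ⟨-C, by rintro _ ⟨v, hv, rfl⟩; exact (abs_le.1 (hv.1 x)).1⟩
  have hule : ∀ v ∈ P, ∀ x, u x ≤ v x := fun v hv x => csInf_le (hbdd x) ⟨v, hv, rfl⟩
  have hleu : ∀ (a : ℝ) x, (∀ v ∈ P, a ≤ v x) → a ≤ u x := fun a x h =>
    le_csInf ⟨_, ⟨_, hPne, rfl⟩⟩ (by rintro _ ⟨v, hv, rfl⟩; exact h v hv)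
  have hubd : ∀ x, |u x| ≤ C := fun x =>
    abs_le.2 ⟨hleu _ x fun v hv => (abs_le.1 (hv.1 x)).1, hule _ hPne x⟩
  have hTu : ∀ x, T u x ≤ u x := fun x => hleu _ x fun v hv =>
    (hTmono u v hubd hv.1 (hule v hv) x).trans (hv.2 x)
  -- By monotonicity `T u` is again a supersolution in `P`, so minimality of `u` gives the missing
  -- inequality.
  have huT : ∀ x, u x = T u x := fun x =>
    le_antisymm (hule (T u) ⟨hTbd u hubd, hTmono (T u) u (hTbd u hubd) hubd hTu⟩ x) (hTu x)
  refine ⟨u, ⟨C, hubd⟩, fun x hx => ?_, fun y => ?_⟩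
  · rw [huT x]
    simp only [hT]
    rw [dif_neg hx]
  · rw [huT y]
    simp only [hT]
    rw [dif_pos y.2]

end TugOfWar

/-! ### Conclusion -/

theorem mainTheorem5 {X : Type*} [MetricSpace X] [CompactSpace X]
    (hX : TugOfWar.IsLengthSpace X)
    (Y : Set X) (hYclosed : IsClosed Y) (hYne : Y.Nonempty)
    (F : Y → ℝ) (hF : ∃ K : NNReal, LipschitzWith K F)
    (ε : ℝ) (hε : 0 < ε) (θ : ℝ) (hθ₁ : -1 < θ) (hθ₂ : θ < 1) :
    ∃ u : X → ℝ,
      (∀ x, TugOfWar.valueI F ε θ x = (u x : EReal)) ∧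
      (∀ x, TugOfWar.valueII F ε θ x = (u x : EReal)) ∧
      TugOfWar.IsBoundedFun u ∧
      TugOfWar.IsInfinityHarmonic Y ε θ u ∧
      (∀ y : Y, u y = F y) ∧
      ∀ v : X → ℝ, TugOfWar.IsBoundedFun v → TugOfWar.IsInfinityHarmonic Y ε θ v →
        (∀ y : Y, v y = F y) → v = u := by
  have := hX.preconnectedSpace
  obtain ⟨C, hC0, hC⟩ : ∃ C : ℝ, 0 ≤ C ∧ ∀ y, |F y| ≤ C := by
    obtain ⟨K, hK⟩ := hF
    have : CompactSpace Y := isCompact_iff_compactSpace.1 hYclosed.isCompact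
    obtain ⟨C, hC⟩ := isCompact_univ.exists_bound_of_continuousOn hK.continuous.continuousOn
    obtain ⟨y, hy⟩ := hYne
    exact ⟨C, (norm_nonneg _).trans (hC ⟨y, hy⟩ (Set.mem_univ _)), fun y => hC y (Set.mem_univ y)⟩
  obtain ⟨u, hub, hu, huF⟩ :=
    TugOfWar.exists_isInfinityHarmonic hC0 hC (ε := ε) hε hθ₁.le hθ₂.le
  -- Stated for every solution `v`, so that it yields both the values and uniqueness.
  have key : ∀ v : X → ℝ, TugOfWar.IsBoundedFun v → TugOfWar.IsInfinityHarmonic Y ε θ v →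
      (∀ y : Y, v y = F y) → ∀ x, TugOfWar.valueI F ε θ x = (v x : EReal) ∧
        TugOfWar.valueII F ε θ x = (v x : EReal) := fun v hvb hv hvF x => by
    have h₁ := TugOfWar.le_valueI hYne hε hθ₁ hθ₂ hvb hv hvF x
    have h₂ := TugOfWar.valueI_le_valueII F ε θ x
    have h₃ := TugOfWar.valueII_le hYne hε hθ₁ hθ₂ hvb hv hvF x
    exact ⟨(h₂.trans h₃).antisymm h₁, h₃.antisymm (h₁.trans h₂)⟩
  refine ⟨u, fun x => (key u hub hu huF x).1, fun x => (key u hub hu huF x).2, hub, hu, huF,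
    fun v hvb hv hvF => funext fun x => ?_⟩
  rw [← EReal.coe_eq_coe_iff, ← (key v hvb hv hvF x).1, (key u hub hu huF x).1]
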